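/- Let $n\in\mathbb{N}$ and $-1\le\lambda\le 1$, and put $\theta=\bigl(1+(-1)^{n-1}\lambda\bigr)/2$. Let $J_n(\theta,-\theta;x)$ be the Jacobi polynomial of degree $n$, that is, the polynomial that for $-1<x<1$ is given by $$J_n(\theta,-\theta;x)=(-1)^n\Bigl(\frac{1-x}{1+x}\Bigr)^{\theta}\frac{n!}{(2n)!}\,\frac{d^n}{dx^n}\Bigl\{(1+x)^{n+\theta}(1-x)^{n-\theta}\Bigr\}.$$ For $\mathbf x=(x_1,\dots,x_n)$ in the simplex $\Delta^n=\{\mathbf x\in\mathbb{R}^n : 0\le x_1\le\dots\le x_n\le 1\}$, let $\Sigma_n(\mathbf x)\in L^\infty[0,1]$ be the class of the function equal to $(-1)^m$ on $[x_m,x_{m+1})$ for $0\le m\le n$, where $x_0=0$ and $x_{n+1}=1$, and equal to $(-1)^n$ at $1$. Let $D_n=\Sigma_n(\Delta^n)$ and $\langle f,g\rangle=\int_0^1 g(t)f(t)\,dt$. Theorem. All $n$ roots of $J_n(\theta,-\theta;x)$, counted with multiplicity, are real. If $\zeta_1,\dots,\zeta_n$ are these roots, ordered so that $|\zeta_1|\le\dots\le|\zeta_n|$,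 and $x_i=|\zeta_i|$, then $\mathbf x=(x_1,\dots,x_n)\in\Delta^n$, and the switch function $\sigma=\Sigma_n(\mathbf x)\in D_n$ satisfies $$\langle p,\sigma-\lambda\rangle=0$$ for every even real polynomial $p$ of degree at most $2n-2$. -/

import Mathlib

open scoped ENNReal

namespace SwitchFunctions

noncomputable section

/-! ### Switch functions on `[0,1]` -/

/-- Lebesgue measure on `[0,1]`. -/
abbrev unitMeasure : MeasureTheory.Measure ℝ :=
  MeasureTheory.volume.restrict (Set.Icc (0 : ℝ) 1)

/-- The real Banach space `L^∞[0,1]`. -/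
abbrev LInfty : Type := MeasureTheory.Lp ℝ ∞ unitMeasure

/-- The standard `n`-simplex `{x ∈ ℝⁿ | 0 ≤ x₁ ≤ x₂ ≤ ⋯ ≤ xₙ ≤ 1}`. The coordinate `xᵢ` is
`x ⟨i - 1, _⟩`. -/
def simplex (n : ℕ) : Set (Fin n → ℝ) :=
  {x | Monotone x ∧ ∀ i, 0 ≤ x i ∧ x i ≤ 1}

/-- The function `t ↦ (-1) ^ #{i | xᵢ ≤ t}`. For `x` in the simplex its value is `(-1)^m` on
`[xₘ, xₘ₊₁)`, where `x₀ = 0` and `xₙ₊₁ = 1`, and `(-1)^n` at `1`; see `switchFun_eq` and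
`switchFun_one` below. -/
def switchFun {n : ℕ} (x : Fin n → ℝ) (t : ℝ) : ℝ :=
  (-1) ^ (Finset.univ.filter fun i => x i ≤ t).card

/-- The sequence `x₀ = 0, x₁, …, xₙ, xₙ₊₁ = 1`. -/
def padded {n : ℕ} (x : Fin n → ℝ) (m : ℕ) : ℝ :=
  if m = 0 then 0 else if h : m - 1 < n then x ⟨m - 1, h⟩ else 1

theorem switchFun_eq {n : ℕ} {x : Fin n → ℝ} (hx : x ∈ simplex n) {m : ℕ} (hm : m ≤ n) {t : ℝ}
    (h₁ : padded x m ≤ t) (h₂ : t < padded x (m + 1)) : switchFun x t = (-1) ^ m := by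
  have key : (Finset.univ.filter fun i => x i ≤ t) =
      Finset.univ.filter fun i : Fin n => (i : ℕ) < m := by
    ext i
    simp only [Finset.mem_filter, Finset.mem_univ, true_and]
    constructor
    · intro hi
      by_contra hlt
      push Not at hlt
      have hmn : m < n := lt_of_le_of_lt hlt i.2
      simp only [padded, Nat.add_sub_cancel, hmn, dif_pos, Nat.succ_ne_zero, if_false] at h₂
      have := hx.1 (show (⟨m, hmn⟩ : Fin n) ≤ i from hlt)
      linarith
    · intro hi
      have hm0 : m ≠ 0 := by omega
      have hmn : m - 1 < n := by omega
      simp only [padded, hm0, hmn, dif_pos, if_false] at h₁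
      have := hx.1 (show i ≤ (⟨m - 1, hmn⟩ : Fin n) from by
        rw [Fin.le_def]; simp only; omega)
      linarith
  have hcard : (Finset.univ.filter fun i : Fin n => (i : ℕ) < m).card = m := by
    rw [Fin.card_filter_val_lt]; omega
  rw [switchFun, key, hcard]

theorem switchFun_one {n : ℕ} {x : Fin n → ℝ} (hx : x ∈ simplex n) :
    switchFun x 1 = (-1) ^ n := by
  have : (Finset.univ.filter fun i => x i ≤ 1) = Finset.univ :=
    Finset.filter_true_of_mem fun i _ => (hx.2 i).2
  rw [switchFun, this, Finset.card_univ, Fintype.card_fin]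

theorem memLp_switchFun {n : ℕ} (x : Fin n → ℝ) :
    MeasureTheory.MemLp (switchFun x) ∞ unitMeasure := by
  have hprod : switchFun x = fun t => ∏ i, if x i ≤ t then (-1 : ℝ) else 1 := by
    funext t
    simp [switchFun, Finset.prod_ite]
  have hmeas : Measurable (switchFun x) := by
    rw [hprod]
    exact Finset.measurable_fun_prod _ fun i _ =>
      Measurable.ite measurableSet_Ici measurable_const measurable_const
  refine MeasureTheory.memLp_top_of_bound hmeas.aestronglyMeasurable 1 ?_
  exact Filter.Eventually.of_forall fun t => by simp [switchFun]

/-- `Σₙ(x)`, the class of `switchFun x` in `L^∞[0,1]`. -/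
def switchClass {n : ℕ} (x : Fin n → ℝ) : LInfty :=
  (memLp_switchFun x).toLp (switchFun x)

/-- `Dₙ = Σₙ(Δⁿ)`, the switch functions with at most `n` switches, parametrised by the simplex. -/
def switchSet (n : ℕ) : Set LInfty := switchClass '' simplex n

/-- The pairing `⟨f, g⟩ = ∫₀¹ g(t) f(t) dt`. -/
def pairing (f g : ℝ → ℝ) : ℝ := ∫ t in (0 : ℝ)..1, g t * f t

/-! ### The Jacobi polynomials with parameters `θ` and `-θ` -/

/-- The Rodrigues expression
`(-1)ⁿ ((1-x)/(1+x))^θ (n!/(2n)!) dⁿ/dxⁿ {(1+x)^(n+θ) (1-x)^(n-θ)}`, meaningful for `|x| < 1`. -/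
def jacobiRodrigues (n : ℕ) (θ x : ℝ) : ℝ :=
  (-1) ^ n * ((1 - x) / (1 + x)) ^ θ * ((n.factorial : ℝ) / ((2 * n).factorial : ℝ)) *
    iteratedDeriv n (fun y : ℝ => (1 + y) ^ ((n : ℝ) + θ) * (1 - y) ^ ((n : ℝ) - θ)) x

/-- The degree `n` Jacobi polynomial `Jₙ(θ, -θ; x)`: the polynomial that equals the Rodrigues
expression on `(-1,1)` (see `jacobi_eval` and `jacobi_unique`), written out by Leibniz' rule. -/
def jacobi (n : ℕ) (θ : ℝ) : Polynomial ℝ :=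
  Polynomial.C ((n.factorial : ℝ) / ((2 * n).factorial : ℝ)) *
    ∑ k ∈ Finset.range (n + 1),
      Polynomial.C ((n.choose k : ℝ) * (descPochhammer ℝ k).eval ((n : ℝ) + θ) *
          (descPochhammer ℝ (n - k)).eval ((n : ℝ) - θ)) *
        ((Polynomial.X + 1) ^ (n - k) * (Polynomial.X - 1) ^ k)

theorem jacobi_eval (n : ℕ) (θ : ℝ) {x : ℝ} (hx : x ∈ Set.Ioo (-1 : ℝ) 1) :
    (jacobi n θ).eval x = jacobiRodrigues n θ x := by
  have hp : 0 < 1 + x := by linarith [hx.1]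
  have hm : 0 < 1 - x := by linarith [hx.2]
  have hc₁ : ContDiffAt ℝ n (fun y : ℝ => (1 + y) ^ ((n : ℝ) + θ)) x :=
    (contDiffAt_const.add contDiffAt_id).rpow_const_of_ne hp.ne'
  have hc₂ : ContDiffAt ℝ n (fun y : ℝ => (1 - y) ^ ((n : ℝ) - θ)) x :=
    (contDiffAt_const.sub contDiffAt_id).rpow_const_of_ne hm.ne'
  have hd₁ : ∀ k : ℕ, iteratedDeriv k (fun y : ℝ => (1 + y) ^ ((n : ℝ) + θ)) x =
      (descPochhammer ℝ k).eval ((n : ℝ) + θ) * (1 + x) ^ ((n : ℝ) + θ - k) := by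
    intro k
    rw [iteratedDeriv_comp_const_add k (fun y : ℝ => y ^ ((n : ℝ) + θ)) 1,
      iteratedDeriv_eq_iterate]
    exact Real.iter_deriv_rpow_const _ _ _
  have hd₂ : ∀ k : ℕ, iteratedDeriv k (fun y : ℝ => (1 - y) ^ ((n : ℝ) - θ)) x =
      (-1) ^ k * ((descPochhammer ℝ k).eval ((n : ℝ) - θ) * (1 - x) ^ ((n : ℝ) - θ - k)) := by
    intro k
    rw [iteratedDeriv_comp_const_sub k (fun y : ℝ => y ^ ((n : ℝ) - θ)) 1,
      iteratedDeriv_eq_iterate]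
    simp only [smul_eq_mul]
    rw [Real.iter_deriv_rpow_const]
  rw [jacobiRodrigues, iteratedDeriv_fun_mul hc₁ hc₂, jacobi, Polynomial.eval_mul,
    Polynomial.eval_C, Polynomial.eval_finsetSum, Finset.mul_sum, Finset.mul_sum]
  refine Finset.sum_congr rfl fun k hk => ?_
  have hkn : k ≤ n := by simpa [Nat.lt_succ_iff] using hk
  rw [hd₁, hd₂]
  simp only [Polynomial.eval_mul, Polynomial.eval_C, Polynomial.eval_pow, Polynomial.eval_add,
    Polynomial.eval_sub, Polynomial.eval_X, Polynomial.eval_one]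
  have e₁ : (1 + x) ^ ((n : ℝ) + θ - k) = (1 + x) ^ θ * (x + 1) ^ (n - k) := by
    rw [← Real.rpow_natCast (x + 1), add_comm x 1, ← Real.rpow_add hp, Nat.cast_sub hkn]
    congr 1; ring
  have e₂ : (1 - x) ^ ((n : ℝ) - θ - (n - k : ℕ)) = ((1 - x) ^ θ)⁻¹ * (1 - x) ^ k := by
    rw [← Real.rpow_natCast (1 - x), ← Real.rpow_neg hm.le, ← Real.rpow_add hm,
      Nat.cast_sub hkn]
    congr 1; ring
  have e₃ : (x - 1) ^ k = (-1) ^ n * (-1) ^ (n - k) * (1 - x) ^ k := by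
    have hs : ((-1 : ℝ)) ^ n * (-1) ^ (n - k) = (-1) ^ k := by
      obtain ⟨j, rfl⟩ := Nat.exists_eq_add_of_le hkn
      rw [Nat.add_sub_cancel_left, pow_add, mul_assoc, ← mul_pow]
      simp
    rw [hs, ← mul_pow]; congr 1; ring
  have h₁ : (1 + x) ^ θ ≠ 0 := (Real.rpow_pos_of_pos hp _).ne'
  have h₂ : (1 - x) ^ θ ≠ 0 := (Real.rpow_pos_of_pos hm _).ne'
  rw [e₁, e₂, e₃, Real.div_rpow hm.le hp.le]
  field_simp

theorem jacobi_unique (n : ℕ) (θ : ℝ) (P : Polynomial ℝ)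
    (hP : ∀ x ∈ Set.Ioo (-1 : ℝ) 1, P.eval x = jacobiRodrigues n θ x) : P = jacobi n θ :=
  Polynomial.eq_of_infinite_eval_eq _ _ <|
    (Set.Ioo_infinite (by norm_num : (-1 : ℝ) < 1)).mono fun x hx =>
      (hP x hx).trans (jacobi_eval n θ hx).symm

/-- `ζ₁, …, ζₙ` is the list of all real roots of `P`, with multiplicity, ordered by absolute
value. If `P` has degree `n`, these are all the complex roots of `P`. -/
def IsOrderedRoots {n : ℕ} (P : Polynomial ℝ) (ζ : Fin n → ℝ) : Prop :=
  P.roots = Multiset.map ζ Finset.univ.val ∧ Monotone fun i => |ζ i|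

end

end SwitchFunctions

/-! Let `s` be the root set of the Jacobi polynomial, A = ∏ (x - a) and B(x) = ∏ (x + a) its
reflection. Rolle's theorem, applied to the successive derivatives in Rodrigues' formula, gives n
distinct roots in (-1,1] (`jacobi_roots`).

A satisfies the Jacobi equation, and B the same equation with θ replaced by -θ. Hence (1 - x²)(A'B -
AB') + 2θAB is constant (`exists_first_integral`). Divided by AB and expanded at infinity, this says
that the odd power sums ∑ a^(2j+1) equal θ for j < n (`sum_odd_pow_eq`). So ∑ₐ ∫₀ᵃ p = θ ∫₀¹ p for
even p of degree at most 2n - 2.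

For even p the left side is ∫₀¹ p N, where N(t) = #{a > t} - #{a < -t} is `signedCount`. The same
first integral, evaluated at the roots, forces the roots of A and B to interlace or to coincide
apart from ±1. Either way N takes only the values 0 and 1 (`signedCount_eq_zero_or_one`). By parity,
the switch function at the points |a| is then (-1)^n (1 - 2N), whose pairing with p is (-1)^n (1 -
2θ) ∫₀¹ p = λ ∫₀¹ p. -/

namespace SwitchFunctions

/-! ### Rodrigues' formula, the differential equation and the location of the roots -/

section

open Polynomial

/-- The polynomial `R` with `dᵏ/dxᵏ {(1+x)^(n+θ) (1-x)^(n-θ)} = (1+x)^(n+θ-k) (1-x)^(n-θ-k) R(x)`. -/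
noncomputable def rodriguesFactor (n : ℕ) (θ : ℝ) : ℕ → ℝ[X]
  | 0 => 1
  | k + 1 => (1 - X ^ 2) * derivative (rodriguesFactor n θ k) +
      (C (2 * θ) - C (2 * ((n : ℝ) - k)) * X) * rodriguesFactor n θ k

/-- Differentiating the recursion and substituting the induction hypothesis makes everything
collapse to a multiple of the recursion itself. With k = n this turns the recursion into the
second-order equation. -/
theorem derivative_rodriguesFactor_succ (n : ℕ) (θ : ℝ) (m : ℕ) :
    derivative (rodriguesFactor n θ (m + 1)) =
      C (((m : ℝ) + 1) * (m - 2 * n)) * rodriguesFactor n θ m := by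
  induction m with
  | zero =>
    simp [rodriguesFactor]
  | succ m ih =>
    have hR : rodriguesFactor n θ (m + 1) = (1 - X ^ 2) * derivative (rodriguesFactor n θ m) +
      (C (2 * θ) - C (2 * ((n : ℝ) - m)) * X) * rodriguesFactor n θ m := rfl
    rw [rodriguesFactor]
    simp only [derivative_add, derivative_mul, derivative_sub, derivative_one, derivative_X_pow,
      derivative_C, derivative_X]
    rw [ih]
    simp only [derivative_mul, derivative_C]
    have key : (1 - X ^ 2) * derivative (rodriguesFactor n θ m) = rodriguesFactor n θ (m + 1) -
      (C (2 * θ) - C (2 * ((n : ℝ) - m)) * X) * rodriguesFactor n θ m := by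
      rw [hR]; ring
    generalize rodriguesFactor n θ (m + 1) = S at *
    simp only [map_mul, map_sub, map_add, map_natCast, map_one, map_ofNat, Nat.cast_add,
      Nat.cast_one, Nat.cast_ofNat] at *
    linear_combination ((m : ℝ[X]) + 1) * ((m : ℝ[X]) - 2 * n) * key

theorem rodriguesFactor_ode (n : ℕ) (θ : ℝ) :
    (1 - X ^ 2) * derivative (derivative (rodriguesFactor n θ n)) +
      (C (2 * θ) - 2 * X) * derivative (rodriguesFactor n θ n) +
      C ((n : ℝ) * (n + 1)) * rodriguesFactor n θ n = 0 := by
  cases n with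
  | zero => simp [rodriguesFactor]
  | succ m =>
    have hR : rodriguesFactor (m + 1) θ (m + 1) =
      (1 - X ^ 2) * derivative (rodriguesFactor (m + 1) θ m) +
      (C (2 * θ) - C (2 * (((m + 1 : ℕ) : ℝ) - m)) * X) * rodriguesFactor (m + 1) θ m := rfl
    rw [derivative_rodriguesFactor_succ]
    simp only [derivative_mul, derivative_C]
    generalize rodriguesFactor (m + 1) θ (m + 1) = S at *
    simp only [map_mul, map_sub, map_add, map_natCast, map_one, map_ofNat, Nat.cast_add,
      Nat.cast_one] at *
    linear_combination ((m : ℝ[X]) + 1) * (m + 2) * hR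

theorem natDegree_rodriguesFactor_le (n : ℕ) (θ : ℝ) (k : ℕ) :
    (rodriguesFactor n θ k).natDegree ≤ k := by
  induction k with
  | zero => simp [rodriguesFactor]
  | succ k ih =>
    rw [rodriguesFactor]
    refine natDegree_add_le_of_degree_le ?_ ?_
    -- The bound k - 1 on the degree of the derivative is truncated at k = 0, where the derivative
    -- has to be seen to vanish.
    · cases k with
      | zero => simp [rodriguesFactor]
      | succ k =>
        rw [derivative_rodriguesFactor_succ] at *
        have h := (natDegree_C_mul_le (((k : ℝ) + 1) * (k - 2 * n)) (rodriguesFactor n θ k))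
        have hd := natDegree_derivative_le (rodriguesFactor n θ (k + 1))
        rw [derivative_rodriguesFactor_succ] at hd
        have h1 : (1 - X ^ 2 : ℝ[X]).natDegree ≤ 2 := by compute_degree
        refine natDegree_mul_le.trans ?_
        omega
    · have h1 : (C (2 * θ) - C (2 * ((n : ℝ) - k)) * X).natDegree ≤ 1 := by compute_degree
      refine natDegree_mul_le.trans ?_
      omega

/-- At -1 the derivative term drops out and each step multiplies by 2θ + 2(n - k) > 0. This serves
as the proof that the factors are nonzero polynomials. -/
theorem rodriguesFactor_eval_neg_one_pos {n : ℕ} {θ : ℝ} (hθ : 0 ≤ θ) {k : ℕ} (hk : k ≤ n) :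
    0 < (rodriguesFactor n θ k).eval (-1) := by
  induction k with
  | zero => simp [rodriguesFactor]
  | succ k ih =>
    have h := ih (by omega)
    have hkn : (k : ℝ) + 1 ≤ n := by exact_mod_cast hk
    rw [rodriguesFactor]
    simp only [eval_add, eval_mul, eval_sub, eval_one, eval_pow, eval_X, eval_C]
    have : 0 < 2 * θ - 2 * ((n : ℝ) - k) * -1 := by linarith
    nlinarith [mul_pos this h]

theorem hasDerivAt_weight_mul (a b : ℝ) (P : ℝ[X]) {x : ℝ} (hx : x ∈ Set.Ioo (-1 : ℝ) 1) :
    HasDerivAt (fun y : ℝ => (1 + y) ^ a * (1 - y) ^ b * P.eval y)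
      ((1 + x) ^ (a - 1) * (1 - x) ^ (b - 1) *
        ((1 - x ^ 2) * (derivative P).eval x + (a - b - (a + b) * x) * P.eval x)) x := by
  have hp : 0 < 1 + x := by linarith [hx.1]
  have hm : 0 < 1 - x := by linarith [hx.2]
  have h₁ := ((hasDerivAt_id x).const_add 1).rpow_const (p := a) (Or.inl hp.ne')
  have h₂ := ((hasDerivAt_id x).const_sub 1).rpow_const (p := b) (Or.inl hm.ne')
  refine ((h₁.mul h₂).mul (P.hasDerivAt x)).congr_deriv ?_
  have e₁ : (1 + x) ^ a = (1 + x) ^ (a - 1) * (1 + x) := by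
    rw [← Real.rpow_add_one hp.ne']; congr 1; ring
  have e₂ : (1 - x) ^ b = (1 - x) ^ (b - 1) * (1 - x) := by
    rw [← Real.rpow_add_one hm.ne']; congr 1; ring
  simp only [id, Pi.mul_apply]
  rw [e₁, e₂]
  ring

theorem iteratedDeriv_weight (n : ℕ) (θ : ℝ) (k : ℕ) {x : ℝ} (hx : x ∈ Set.Ioo (-1 : ℝ) 1) :
    iteratedDeriv k (fun y : ℝ => (1 + y) ^ ((n : ℝ) + θ) * (1 - y) ^ ((n : ℝ) - θ)) x =
      (1 + x) ^ ((n : ℝ) + θ - k) * (1 - x) ^ ((n : ℝ) - θ - k) *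
        (rodriguesFactor n θ k).eval x := by
  induction k generalizing x with
  | zero => simp [rodriguesFactor]
  | succ k ih =>
    rw [iteratedDeriv_succ]
    have hev : iteratedDeriv k
        (fun y : ℝ => (1 + y) ^ ((n : ℝ) + θ) * (1 - y) ^ ((n : ℝ) - θ)) =ᶠ[nhds x]
        fun y => (1 + y) ^ ((n : ℝ) + θ - k) * (1 - y) ^ ((n : ℝ) - θ - k) *
          (rodriguesFactor n θ k).eval y := by
      filter_upwards [isOpen_Ioo.mem_nhds hx] with y hy using ih hy
    rw [hev.deriv_eq, (hasDerivAt_weight_mul _ _ _ hx).deriv, rodriguesFactor]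
    simp only [eval_add, eval_mul, eval_sub, eval_one, eval_pow, eval_X, eval_C, Nat.cast_add,
      Nat.cast_one, ← sub_sub]
    ring

theorem jacobi_eq_rodriguesFactor (n : ℕ) (θ : ℝ) :
    jacobi n θ = C ((-1) ^ n * ((n.factorial : ℝ) / ((2 * n).factorial : ℝ))) *
      rodriguesFactor n θ n := by
  symm
  refine jacobi_unique n θ _ fun x hx => ?_
  have hp : 0 < 1 + x := by linarith [hx.1]
  have hm : 0 < 1 - x := by linarith [hx.2]
  rw [jacobiRodrigues, iteratedDeriv_weight n θ n hx, eval_mul, eval_C,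
    Real.div_rpow hm.le hp.le, show (n : ℝ) + θ - n = θ by ring,
    show (n : ℝ) - θ - n = -θ by ring, Real.rpow_neg hm.le]
  have h₁ : (1 + x) ^ θ ≠ 0 := (Real.rpow_pos_of_pos hp _).ne'
  have h₂ : (1 - x) ^ θ ≠ 0 := (Real.rpow_pos_of_pos hm _).ne'
  field_simp

theorem jacobi_ode (n : ℕ) (θ : ℝ) :
    (1 - X ^ 2) * derivative (derivative (jacobi n θ)) +
      (C (2 * θ) - 2 * X) * derivative (jacobi n θ) +
      C ((n : ℝ) * (n + 1)) * jacobi n θ = 0 := by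
  rw [jacobi_eq_rodriguesFactor]
  simp only [derivative_C_mul]
  linear_combination C ((-1) ^ n * ((n.factorial : ℝ) / ((2 * n).factorial : ℝ))) *
    rodriguesFactor_ode n θ

/-- Rolle's theorem for `(1+x)^a (1-x)^b P(x)`. -/
theorem exists_root_of_weight_mul_eq_zero {a b : ℝ} (ha : 0 ≤ a) (hb : 0 ≤ b) (P : ℝ[X])
    {x y : ℝ} (hx : -1 ≤ x) (hy : y ≤ 1) (hxy : x < y)
    (hfx : (1 + x) ^ a * (1 - x) ^ b * P.eval x = 0)
    (hfy : (1 + y) ^ a * (1 - y) ^ b * P.eval y = 0) :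
    ∃ z ∈ Set.Ioo x y,
      (1 - z ^ 2) * (derivative P).eval z + (a - b - (a + b) * z) * P.eval z = 0 := by
  have hc : Continuous fun y : ℝ => (1 + y) ^ a * (1 - y) ^ b * P.eval y :=
    (((continuous_const.add continuous_id).rpow_const fun _ => Or.inr ha).mul
      ((continuous_const.sub continuous_id).rpow_const fun _ => Or.inr hb)).mul P.continuous
  obtain ⟨z, hz, hdz⟩ := exists_deriv_eq_zero hxy hc.continuousOn (hfx.trans hfy.symm)
  have hz' : z ∈ Set.Ioo (-1 : ℝ) 1 := ⟨hx.trans_lt hz.1, hz.2.trans_le hy⟩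
  refine ⟨z, hz, ?_⟩
  rw [(hasDerivAt_weight_mul a b P hz').deriv] at hdz
  have h₁ : (1 + z) ^ (a - 1) ≠ 0 := (Real.rpow_pos_of_pos (by linarith [hz'.1]) _).ne'
  have h₂ : (1 - z) ^ (b - 1) ≠ 0 := (Real.rpow_pos_of_pos (by linarith [hz'.2]) _).ne'
  simpa [h₁, h₂] using hdz

theorem rodriguesFactor_succ_roots {n : ℕ} {θ : ℝ} (h0 : 0 ≤ θ) {k : ℕ} (hk : k < n)
    (hb : 0 ≤ (n : ℝ) - θ - k) (s : Finset ℝ)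
    (hs : ∀ x ∈ s, -1 ≤ x ∧ x ≤ 1 ∧ (1 + x) ^ ((n : ℝ) + θ - k) * (1 - x) ^ ((n : ℝ) - θ - k) *
      (rodriguesFactor n θ k).eval x = 0) :
    ∃ t : Finset ℝ, s.card ≤ t.card + 1 ∧
      ∀ x ∈ t, x ∈ Set.Ioo (-1 : ℝ) 1 ∧ (rodriguesFactor n θ (k + 1)).eval x = 0 := by
  have hne : rodriguesFactor n θ (k + 1) ≠ 0 := by
    intro h
    have := rodriguesFactor_eval_neg_one_pos h0 (n := n) (k := k + 1) hk
    simp [h] at this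
  have hkn : (k : ℝ) + 1 ≤ n := by exact_mod_cast hk
  refine ⟨(rodriguesFactor n θ (k + 1)).roots.toFinset.filter (· ∈ Set.Ioo (-1 : ℝ) 1),
    Finset.card_le_of_interleaved fun x hx y hy hxy _ => ?_, fun x hx => ?_⟩
  · obtain ⟨hx1, -, hx2⟩ := hs x hx
    obtain ⟨-, hy1, hy2⟩ := hs y hy
    obtain ⟨z, hz, hzr⟩ := exists_root_of_weight_mul_eq_zero (by linarith) hb _ hx1 hy1 hxy hx2 hy2
    refine ⟨z, ?_, hz.1, hz.2⟩
    simp only [Finset.mem_filter, Multiset.mem_toFinset, mem_roots hne, IsRoot]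
    refine ⟨?_, hx1.trans_lt hz.1, hz.2.trans_le hy1⟩
    rw [← hzr, rodriguesFactor]
    simp only [eval_add, eval_mul, eval_sub, eval_one, eval_pow, eval_X, eval_C]
    ring
  · simp only [Finset.mem_filter, Multiset.mem_toFinset, mem_roots hne, IsRoot] at hx
    exact ⟨hx.2, hx.1⟩

/-- While both exponents are positive, the weighted product also vanishes at ±1, so k interior zeros
become k + 2 zeros and Rolle returns k + 1. The bound `hb` keeps the exponent of 1 - x positive at
every step taken. -/
theorem rodriguesFactor_roots_of_lt {n : ℕ} {θ : ℝ} (h0 : 0 ≤ θ) {k : ℕ} (hk : k ≤ n)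
    (hb : (k : ℝ) < n - θ + 1) :
    ∃ t : Finset ℝ, k ≤ t.card ∧
      ∀ x ∈ t, x ∈ Set.Ioo (-1 : ℝ) 1 ∧ (rodriguesFactor n θ k).eval x = 0 := by
  induction k with
  | zero => exact ⟨∅, by simp⟩
  | succ k ih =>
    push_cast at hb
    have hkn : (k : ℝ) + 1 ≤ n := by exact_mod_cast hk
    obtain ⟨t, htc, ht⟩ := ih (by omega) (by linarith)
    obtain ⟨t', htc', ht'⟩ := rodriguesFactor_succ_roots h0 (n := n) (k := k) (by omega) (by linarith)
      (insert (-1) (insert 1 t)) (by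
        intro x hx
        simp only [Finset.mem_insert] at hx
        rcases hx with rfl | rfl | hx
        · refine ⟨le_rfl, by norm_num, ?_⟩
          rw [show (1 : ℝ) + -1 = 0 by norm_num, Real.zero_rpow (by linarith)]; simp
        · refine ⟨by norm_num, le_rfl, ?_⟩
          rw [sub_self, Real.zero_rpow (by linarith)]; simp
        · obtain ⟨h1, h2⟩ := ht x hx
          exact ⟨h1.1.le, h1.2.le, by rw [h2, mul_zero]⟩)
    refine ⟨t', ?_, ht'⟩
    rw [Finset.card_insert_of_notMem, Finset.card_insert_of_notMem] at htc'
    · omega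
    · exact fun h => absurd (ht 1 h).1.2 (lt_irrefl _)
    · simp only [Finset.mem_insert, not_or]
      exact ⟨by norm_num, fun h => absurd (ht _ h).1.1 (lt_irrefl _)⟩

theorem rodriguesFactor_roots {n : ℕ} {θ : ℝ} (h0 : 0 ≤ θ) (h1 : θ ≤ 1) :
    ∃ t : Finset ℝ, n ≤ t.card ∧
      ∀ x ∈ t, x ∈ Set.Ioc (-1 : ℝ) 1 ∧ (rodriguesFactor n θ n).eval x = 0 := by
  rcases h1.lt_or_eq with h1 | rfl
  · obtain ⟨t, htc, ht⟩ := rodriguesFactor_roots_of_lt (n := n) h0 le_rfl (by linarith)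
    exact ⟨t, htc, fun x hx => ⟨⟨(ht x hx).1.1, (ht x hx).1.2.le⟩, (ht x hx).2⟩⟩
  -- For θ = 1 the exponent of 1 - x reaches 0 just before the last step. The endpoint 1 is then
  -- lost to Rolle, but the last recursion makes 1 itself a root, since 2θ - 2 = 0.
  · cases n with
    | zero => exact ⟨∅, by simp⟩
    | succ m =>
      obtain ⟨t, htc, ht⟩ := rodriguesFactor_roots_of_lt (n := m + 1) h0 (k := m) (by omega)
        (by push_cast; linarith)
      obtain ⟨t', htc', ht'⟩ := rodriguesFactor_succ_roots h0 (n := m + 1) (k := m) (by omega)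
        (by push_cast; linarith) (insert (-1) t) (by
          intro x hx
          simp only [Finset.mem_insert] at hx
          rcases hx with rfl | hx
          · refine ⟨le_rfl, by norm_num, ?_⟩
            rw [show (1 : ℝ) + -1 = 0 by norm_num, Real.zero_rpow (by push_cast; linarith)]; simp
          · obtain ⟨h1, h2⟩ := ht x hx
            exact ⟨h1.1.le, h1.2.le, by rw [h2, mul_zero]⟩)
      rw [Finset.card_insert_of_notMem fun h => absurd (ht _ h).1.1 (lt_irrefl _)] at htc'
      refine ⟨insert 1 t', ?_, ?_⟩
      · rw [Finset.card_insert_of_notMem fun h => absurd (ht' _ h).1.2 (lt_irrefl _)]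
        omega
      · intro x hx
        simp only [Finset.mem_insert] at hx
        rcases hx with rfl | hx
        · refine ⟨by norm_num, ?_⟩
          rw [rodriguesFactor]
          simp
        · exact ⟨⟨(ht' x hx).1.1, (ht' x hx).1.2.le⟩, (ht' x hx).2⟩

theorem jacobi_roots {n : ℕ} {θ : ℝ} (h0 : 0 ≤ θ) (h1 : θ ≤ 1) :
    ∃ s : Finset ℝ, s.card = n ∧ (∀ x ∈ s, x ∈ Set.Ioc (-1 : ℝ) 1) ∧
      (jacobi n θ).roots = s.val ∧ ∃ c : ℝ, c ≠ 0 ∧ jacobi n θ = C c * ∏ a ∈ s, (X - C a) := by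
  have hc : (-1) ^ n * ((n.factorial : ℝ) / ((2 * n).factorial : ℝ)) ≠ 0 := by positivity
  have hne : jacobi n θ ≠ 0 := by
    intro h
    have := rodriguesFactor_eval_neg_one_pos h0 (n := n) le_rfl
    rw [jacobi_eq_rodriguesFactor, mul_eq_zero, C_eq_zero] at h
    simp [h.resolve_left hc] at this
  have hdeg : (jacobi n θ).natDegree ≤ n := by
    rw [jacobi_eq_rodriguesFactor]
    exact (natDegree_C_mul_le _ _).trans (natDegree_rodriguesFactor_le _ _ _)
  obtain ⟨s, hs, hroot⟩ := rodriguesFactor_roots (n := n) h0 h1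
  have hle : s.val ≤ (jacobi n θ).roots := by
    rw [Finset.val_le_iff_val_subset]
    intro x hx
    rw [mem_roots hne, IsRoot, jacobi_eq_rodriguesFactor, eval_mul, (hroot x hx).2, mul_zero]
  have hcard := card_roots' (jacobi n θ)
  have hsc : s.card ≤ (jacobi n θ).roots.card := Multiset.card_le_card hle
  have heq : (jacobi n θ).roots = s.val :=
    (Multiset.eq_of_le_of_card_le hle (by simp only [Finset.card_val]; omega)).symm
  refine ⟨s, by omega, fun x hx => (hroot x hx).1, heq, (jacobi n θ).leadingCoeff,
    leadingCoeff_ne_zero.2 hne, ?_⟩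
  have := C_leadingCoeff_mul_prod_multiset_X_sub_C (p := jacobi n θ) (by omega)
  rw [heq] at this
  exact this.symm

end

/-! ### The first integral and the odd power sums of the roots -/

section

open Polynomial

/-- The substitution x ↦ -x carries A to ±B and reverses the sign of θ. -/
theorem prod_X_add_C_ode (s : Finset ℝ) (θ c : ℝ)
    (hA : (1 - X ^ 2) * derivative (derivative (∏ a ∈ s, (X - C a))) +
      (C (2 * θ) - 2 * X) * derivative (∏ a ∈ s, (X - C a)) + C c * ∏ a ∈ s, (X - C a) = 0) :
    (1 - X ^ 2) * derivative (derivative (∏ a ∈ s, (X + C a))) -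
      (C (2 * θ) + 2 * X) * derivative (∏ a ∈ s, (X + C a)) + C c * ∏ a ∈ s, (X + C a) = 0 := by
  have hB : ∏ a ∈ s, (X + C a) = C ((-1) ^ s.card) * (∏ a ∈ s, (X - C a)).comp (-X) := by
    rw [prod_comp, map_pow, ← Finset.prod_const, ← Finset.prod_mul_distrib]
    refine Finset.prod_congr rfl fun a _ => ?_
    simp
    ring
  rw [hB]
  have := congrArg (fun P : ℝ[X] => C ((-1) ^ s.card) * P.comp (-X)) hA
  generalize ∏ a ∈ s, (X - C a) = A at *
  simp only [derivative_C_mul, derivative_comp, derivative_neg, derivative_X, mul_comp, neg_mul,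
    one_mul, mul_neg, neg_neg, add_comp, sub_comp, C_comp, X_comp, pow_comp, one_comp,
    ofNat_comp, zero_comp, Nat.cast_ofNat] at *
  linear_combination this

/-- The first integral of the differential equation, written in terms of the roots. -/
theorem exists_first_integral (s : Finset ℝ) (θ c : ℝ)
    (hA : (1 - X ^ 2) * derivative (derivative (∏ a ∈ s, (X - C a))) +
      (C (2 * θ) - 2 * X) * derivative (∏ a ∈ s, (X - C a)) + C c * ∏ a ∈ s, (X - C a) = 0) :
    ∃ K : ℝ, (X ^ 2 - 1) * ∑ a ∈ s, C a * ∏ b ∈ s.erase a, (X ^ 2 - C (b ^ 2)) =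
      C θ * ∏ a ∈ s, (X ^ 2 - C (a ^ 2)) + C K := by
  have hB := prod_X_add_C_ode s θ c hA
  have hsq : ∀ a : ℝ, (X ^ 2 - C (a ^ 2) : ℝ[X]) = (X - C a) * (X + C a) := by
    intro a; rw [map_pow]; ring
  have hAB : ∏ a ∈ s, (X ^ 2 - C (a ^ 2)) = (∏ a ∈ s, (X - C a)) * ∏ a ∈ s, (X + C a) := by
    rw [← Finset.prod_mul_distrib]
    exact Finset.prod_congr rfl fun a _ => hsq a
  have hW : 2 * ∑ a ∈ s, C a * ∏ b ∈ s.erase a, (X ^ 2 - C (b ^ 2)) =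
      derivative (∏ a ∈ s, (X - C a)) * ∏ a ∈ s, (X + C a) -
        (∏ a ∈ s, (X - C a)) * derivative (∏ a ∈ s, (X + C a)) := by
    rw [derivative_prod_finset, derivative_prod_finset, Finset.sum_mul, Finset.mul_sum,
      Finset.mul_sum, ← Finset.sum_sub_distrib]
    refine Finset.sum_congr rfl fun a ha => ?_
    rw [← Finset.mul_prod_erase s (fun a => (X - C a : ℝ[X])) ha,
      ← Finset.mul_prod_erase s (fun a => (X + C a : ℝ[X])) ha]
    simp only [hsq, Finset.prod_mul_distrib, derivative_sub, derivative_add, derivative_X,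
      derivative_C]
    ring
  rw [hAB]
  set A := ∏ a ∈ s, (X - C a)
  set B := ∏ a ∈ s, (X + C a)
  set Q := ∑ a ∈ s, C a * ∏ b ∈ s.erase a, (X ^ 2 - C (b ^ 2))
  -- In A times the equation of B minus B times that of A, the terms in c cancel and the rest is an
  -- exact derivative.
  have hder : derivative ((X ^ 2 - 1) * (2 * Q) - 2 * (C θ * (A * B))) = 0 := by
    rw [hW]
    simp only [derivative_mul, derivative_sub, derivative_C, derivative_X_pow, derivative_one,
      derivative_ofNat]
    simp only [map_mul, map_ofNat, Nat.cast_ofNat] at *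
    linear_combination A * hB - B * hA
  have h2 : (X ^ 2 - 1) * (2 * Q) - 2 * (C θ * (A * B)) =
      2 * ((X ^ 2 - 1) * Q - C θ * (A * B)) := by ring
  rw [h2, ← C_ofNat, derivative_C_mul, mul_eq_zero, C_eq_zero] at hder
  have hd := hder.resolve_left (by norm_num)
  refine ⟨((X ^ 2 - 1) * Q - C θ * (A * B)).coeff 0, ?_⟩
  rw [← eq_C_of_derivative_eq_zero hd]
  ring

/-- This is the expansion at infinity of (x² - 1) ∑ a/(x² - a²) = θ + K/P, done by polynomial
division. The quotient of X² Qⱼ by P is the j-th odd power sum and the remainder is Qⱼ₊₁. The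
invariant is (X² - 1) Qⱼ = θP + K X^(2j), and for j < n the K term cannot reach the coefficient of
X^(2n). -/
theorem sum_odd_pow_eq (s : Finset ℝ) (θ K : ℝ)
    (h : (X ^ 2 - 1) * ∑ a ∈ s, C a * ∏ b ∈ s.erase a, (X ^ 2 - C (b ^ 2)) =
      C θ * ∏ a ∈ s, (X ^ 2 - C (a ^ 2)) + C K) {j : ℕ} (hj : j < s.card) :
    ∑ a ∈ s, a ^ (2 * j + 1) = θ := by
  set P : ℝ[X] := ∏ a ∈ s, (X ^ 2 - C (a ^ 2)) with hP
  set Q : ℕ → ℝ[X] := fun j => ∑ a ∈ s, C (a ^ (2 * j + 1)) * ∏ b ∈ s.erase a, (X ^ 2 - C (b ^ 2))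
    with hQ
  have hdegprod : ∀ t : Finset ℝ, (∏ b ∈ t, (X ^ 2 - C (b ^ 2))).natDegree = 2 * t.card := by
    intro t
    rw [natDegree_prod_of_monic _ _ fun b _ => monic_X_pow_sub_C _ two_ne_zero]
    simp only [natDegree_X_pow_sub_C, Finset.sum_const, smul_eq_mul, mul_comm]
  have hPc : P.coeff (2 * s.card) = 1 := by
    rw [← hdegprod s]
    exact monic_prod_of_monic _ _ fun b _ => monic_X_pow_sub_C _ two_ne_zero
  have hQc : ∀ j, (Q j).coeff (2 * s.card) = 0 := by
    intro j
    simp only [hQ, finsetSum_coeff, coeff_C_mul]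
    refine Finset.sum_eq_zero fun a ha => ?_
    rw [coeff_eq_zero_of_natDegree_lt, mul_zero]
    rw [hdegprod, Finset.card_erase_of_mem ha]
    have := Finset.card_pos.2 ⟨a, ha⟩
    omega
  have hrec : ∀ j, X ^ 2 * Q j = Q (j + 1) + C (∑ a ∈ s, a ^ (2 * j + 1)) * P := by
    intro j
    simp only [hQ, map_sum, Finset.sum_mul, Finset.mul_sum, ← Finset.sum_add_distrib]
    refine Finset.sum_congr rfl fun a ha => ?_
    rw [hP, ← Finset.mul_prod_erase s _ ha]
    simp only [map_pow]
    ring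
  have hstep : ∀ j < s.card, (X ^ 2 - 1) * Q j = C θ * P + C K * X ^ (2 * j) →
      ∑ a ∈ s, a ^ (2 * j + 1) = θ := by
    intro j hj hQj
    have hp := congrArg (fun p : ℝ[X] => p.coeff (2 * s.card))
      (show Q (j + 1) + C (∑ a ∈ s, a ^ (2 * j + 1)) * P = Q j + C θ * P + C K * X ^ (2 * j) by
        rw [← hrec]; linear_combination hQj)
    simp only [coeff_add, coeff_C_mul, hQc, hPc, coeff_X_pow] at hp
    rw [if_neg (by omega)] at hp
    linarith
  have hall : ∀ j ≤ s.card, (X ^ 2 - 1) * Q j = C θ * P + C K * X ^ (2 * j) := by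
    intro j
    induction j with
    | zero => intro _; simpa [hQ] using h
    | succ j ih =>
      intro hj
      have h1 := ih (by omega)
      have h2 := hrec j
      rw [hstep j (by omega) h1] at h2
      have h3 : (X : ℝ[X]) ^ (2 * (j + 1)) = X ^ 2 * X ^ (2 * j) := by ring
      rw [h3]
      linear_combination X ^ 2 * h1 - (X ^ 2 - 1) * h2
  exact hstep j hj (hall j hj.le)

end

/-! ### Interlacing of the roots with their negatives -/

/-- The product over `s.erase x` is A'(x) when x is a root and A(x) otherwise. One statement thus
covers consecutive roots, where A' alternates in sign, and also the pair formed by -1 and the least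
root. -/
theorem prod_erase_mul_prod_erase_neg {s : Finset ℝ} {x y : ℝ} (hy : y ∈ s) (hxy : x < y)
    (hgap : ∀ a ∈ s, a ∉ Set.Ioo x y) :
    (∏ a ∈ s.erase x, (x - a)) * ∏ a ∈ s.erase y, (y - a) < 0 := by
  have hpos : 0 < ∏ a ∈ (s.erase x).erase y, ((x - a) * (y - a)) := by
    refine Finset.prod_pos fun a ha => ?_
    simp only [Finset.mem_erase] at ha
    rcases lt_or_ge x a with h | h
    · have hya : y < a := lt_of_le_of_ne (not_lt.1 fun h' => hgap a ha.2.2 ⟨h, h'⟩) (Ne.symm ha.1)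
      nlinarith [mul_pos (sub_pos.2 h) (sub_pos.2 hya)]
    · have hxa : a < x := lt_of_le_of_ne h ha.2.1
      exact mul_pos (sub_pos.2 hxa) (sub_pos.2 (hxa.trans hxy))
  rw [Finset.prod_mul_distrib] at hpos
  rw [← Finset.mul_prod_erase (s.erase x) (fun a => x - a) (Finset.mem_erase.2 ⟨hxy.ne', hy⟩)]
  by_cases hx : x ∈ s
  · rw [← Finset.mul_prod_erase (s.erase y) (fun a => y - a) (Finset.mem_erase.2 ⟨hxy.ne, hx⟩),
      Finset.erase_right_comm (s := s) (a := y)]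
    nlinarith [mul_pos hpos (mul_pos (sub_pos.2 hxy) (sub_pos.2 hxy))]
  · rw [Finset.erase_eq_of_notMem hx] at hpos ⊢
    nlinarith [mul_pos hpos (sub_pos.2 hxy)]

theorem exists_neg_mem_of_prod_add_mul_neg {s : Finset ℝ} {x y : ℝ} (hxy : x < y)
    (h : (∏ a ∈ s, (x + a)) * ∏ a ∈ s, (y + a) < 0) : ∃ a ∈ s, x < -a ∧ -a < y := by
  have hc : ContinuousOn (fun t : ℝ => ∏ a ∈ s, (t + a)) (Set.Icc x y) := by fun_prop
  obtain ⟨z, hz, hz0⟩ : ∃ z ∈ Set.Icc x y, ∏ a ∈ s, (z + a) = 0 := by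
    rcases mul_neg_iff.1 h with ⟨h1, h2⟩ | ⟨h1, h2⟩
    · exact intermediate_value_Icc' hxy.le hc ⟨h2.le, h1.le⟩
    · exact intermediate_value_Icc hxy.le hc ⟨h1.le, h2.le⟩
  obtain ⟨a, ha, hza⟩ := Finset.prod_eq_zero_iff.1 hz0
  obtain rfl : z = -a := by linarith
  refine ⟨a, ha, lt_of_le_of_ne hz.1 ?_, lt_of_le_of_ne hz.2 ?_⟩
  · rintro rfl
    rw [hz0, zero_mul] at h
    exact lt_irrefl _ h
  · rintro rfl
    rw [hz0, mul_zero] at h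
    exact lt_irrefl _ h

/-- The number of elements of `s` above `t` minus the number of those below `-t`. -/
noncomputable def signedCount (s : Finset ℝ) (t : ℝ) : ℤ :=
  ((s.filter (t < ·)).card : ℤ) - (s.filter (· < -t)).card

theorem signedCount_of_symm {s : Finset ℝ}
    (hsymm : ∀ a ∈ s, a ≠ 1 → -a ∈ s) {t : ℝ} (ht : 0 ≤ t) :
    signedCount s t = 0 ∨ signedCount s t = 1 := by
  have h1 : (s.filter (· < -t)).card ≤ (s.filter (t < ·)).card := by
    refine Finset.card_le_card_of_injOn (fun a => -a) (fun a ha => ?_) neg_injective.injOn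
    simp only [Finset.coe_filter, Set.mem_ofPred_eq] at ha ⊢
    by_cases h : a = 1
    · linarith
    · exact ⟨hsymm a ha.1 h, by linarith⟩
  have h2 : (s.filter (t < ·)).card ≤ (insert 1 ((s.filter (· < -t)).image (fun a => -a))).card := by
    refine Finset.card_le_card fun a ha => ?_
    simp only [Finset.mem_insert, Finset.mem_image, Finset.mem_filter] at ha ⊢
    by_cases h : a = 1
    · exact Or.inl h
    · exact Or.inr ⟨-a, ⟨hsymm a ha.1 h, by linarith⟩, neg_neg a⟩
  have h3 := Finset.card_insert_le (1 : ℝ) ((s.filter (· < -t)).image (fun a => -a))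
  have h4 := Finset.card_image_le (s := s.filter (· < -t)) (f := fun a : ℝ => -a)
  rw [signedCount]
  omega

/-- Interlacing of the points of `s` with those of `-s`, from the first integral evaluated at
those points. -/
theorem signedCount_eq_zero_or_one {s : Finset ℝ} (hs : ∀ a ∈ s, a ∈ Set.Ioc (-1 : ℝ) 1)
    {θ K : ℝ} (h0 : 0 ≤ θ)
    (h : ∀ x : ℝ, (x ^ 2 - 1) * ∑ a ∈ s, a * ∏ b ∈ s.erase a, (x ^ 2 - b ^ 2) =
      θ * ∏ a ∈ s, (x ^ 2 - a ^ 2) + K) {t : ℝ} (ht : 0 ≤ t) :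
    signedCount s t = 0 ∨ signedCount s t = 1 := by
  -- At a root only the term a = x of the sum survives; the 2 comes from the factor x + x of B(x).
  have hat : ∀ x ∈ s, (x ^ 2 - 1) * ((∏ a ∈ s.erase x, (x - a)) * ∏ a ∈ s, (x + a)) = 2 * K := by
    intro x hx
    have hx' := h x
    rw [Finset.prod_eq_zero (f := fun a => x ^ 2 - a ^ 2) hx (sub_self _), Finset.sum_eq_single_of_mem x hx] at hx'
    · rw [← Finset.mul_prod_erase s (fun a => x + a) hx]
      simp only [sq_sub_sq] at hx'
      simp only [Finset.prod_mul_distrib] at hx'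
      linear_combination 2 * hx'
    · intro b _ hbx
      rw [Finset.prod_eq_zero (f := fun a => x ^ 2 - a ^ 2) (Finset.mem_erase.2 ⟨hbx.symm, hx⟩) (sub_self _), mul_zero]
  by_cases hK : K = 0
  -- If K = 0, every root a ≠ 1 has A'(a) ≠ 0 and hence B(a) = 0, so -a is a root as well.
  · refine signedCount_of_symm (fun a ha ha1 => ?_) ht
    have h1 := hat a ha
    have hne : a ^ 2 - 1 ≠ 0 := by
      have := hs a ha
      have h2 : a < 1 := lt_of_le_of_ne this.2 ha1
      nlinarith [this.1]
    have hne' : ∏ b ∈ s.erase a, (a - b) ≠ 0 :=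
      Finset.prod_ne_zero_iff.2 fun b hb => sub_ne_zero.2 (Finset.ne_of_mem_erase hb).symm
    rw [hK, mul_zero, mul_eq_zero, mul_eq_zero] at h1
    obtain ⟨b, hb, hab⟩ := Finset.prod_eq_zero_iff.1 ((h1.resolve_left hne).resolve_left hne')
    obtain rfl : b = -a := by linarith
    exact hb
  · have hs1 : ∀ a ∈ s, a ∈ Set.Ioo (-1 : ℝ) 1 := by
      intro a ha
      refine ⟨(hs a ha).1, lt_of_le_of_ne (hs a ha).2 ?_⟩
      rintro rfl
      have := hat 1 ha
      apply hK
      linarith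
    have hneg1 : (-1 : ℝ) ∉ s := fun h => lt_irrefl _ (hs1 _ h).1
    -- A'B has sign opposite to K at every root, because x² - 1 < 0 there. At -1 the first integral
    -- reads θAB = -K, so θ ≥ 0 gives AB the same sign. Thus B must change sign wherever A' (or A at
    -- -1) does.
    have hsign : ∀ x ∈ insert (-1) s,
        (∏ a ∈ s.erase x, (x - a)) * (∏ a ∈ s, (x + a)) * K < 0 := by
      intro x hx
      have hK2 : 0 < K * K := mul_self_pos.2 hK
      rcases Finset.mem_insert.1 hx with rfl | hx
      · rw [Finset.erase_eq_of_notMem hneg1, ← Finset.prod_mul_distrib]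
        have h1 := h (-1)
        simp only [sq_sub_sq] at h1
        have h2 : K = -θ * ∏ a ∈ s, ((-1 - a) * (-1 + a)) := by
          simp only [mul_comm (-1 - _ : ℝ)]
          linear_combination -h1
        by_contra hcon
        have h3 : K * K = -(θ * ((∏ a ∈ s, ((-1 - a) * (-1 + a))) * K)) := by
          linear_combination K * h2
        linarith [mul_nonneg h0 (not_lt.1 hcon)]
      · have h1 := hat x hx
        have h2 : 0 < 1 - x ^ 2 := by nlinarith [(hs1 x hx).1, (hs1 x hx).2]
        by_contra hcon
        have h3 : 2 * (K * K) = -((1 - x ^ 2) *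
            ((∏ a ∈ s.erase x, (x - a)) * (∏ a ∈ s, (x + a)) * K)) := by
          linear_combination -K * h1
        linarith [mul_nonneg h2.le (not_lt.1 hcon)]
    have hroot : ∀ x ∈ insert (-1) s, ∀ y ∈ s, x < y → (∀ a ∈ s, a ∉ Set.Ioo x y) →
        ∃ a ∈ s, x < -a ∧ -a < y := by
      intro x hx y hy hxy hgap
      refine exists_neg_mem_of_prod_add_mul_neg hxy ?_
      have h1 := prod_erase_mul_prod_erase_neg hy hxy hgap
      have h2 := mul_pos_of_neg_of_neg (hsign x hx) (hsign y (Finset.mem_insert_of_mem hy))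
      by_contra hcon
      nlinarith [mul_nonneg (neg_pos.2 h1).le (mul_nonneg (not_lt.1 hcon) (mul_self_nonneg K))]
    have hup : (s.filter (t < ·)).card ≤ ((s.filter (· < -t)).image (fun a => -a)).card + 1 := by
      refine Finset.card_le_of_interleaved fun x hx y hy hxy hgap => ?_
      simp only [Finset.mem_filter] at hx hy hgap
      obtain ⟨a, ha, hxa, hay⟩ := hroot x (Finset.mem_insert_of_mem hx.1) y hy.1 hxy
        fun a ha hh => hgap a ⟨ha, hx.2.trans hh.1⟩ hh
      exact ⟨-a, Finset.mem_image.2 ⟨a, Finset.mem_filter.2 ⟨ha, by linarith⟩, rfl⟩, hxa, hay⟩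
    -- Adjoining -1 gains one more gap, which improves the bound to #{a < -t} ≤ #{a > t}.
    have hlow : (insert (-1) (s.filter (· < -t))).card ≤
        ((s.filter (t < ·)).image (fun a => -a)).card + 1 := by
      refine Finset.card_le_of_interleaved fun x hx y hy hxy hgap => ?_
      simp only [Finset.mem_insert, Finset.mem_filter] at hx hy hgap
      have hy' : y ∈ s ∧ y < -t := by
        refine hy.resolve_left ?_
        rintro rfl
        rcases hx with rfl | hx
        · exact lt_irrefl _ hxy
        · exact lt_asymm hxy (hs1 x hx.1).1
      obtain ⟨a, ha, hxa, hay⟩ := hroot x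
        (Finset.mem_insert.2 (hx.imp id And.left)) y hy'.1 hxy
        fun a ha hh => hgap a (Or.inr ⟨ha, hh.2.trans hy'.2⟩) hh
      exact ⟨-a, Finset.mem_image.2 ⟨a, Finset.mem_filter.2 ⟨ha, by linarith⟩, rfl⟩, hxa, hay⟩
    rw [Finset.card_insert_of_notMem fun h => hneg1 (Finset.mem_filter.1 h).1] at hlow
    have h4 := Finset.card_image_le (s := s.filter (· < -t)) (f := fun a : ℝ => -a)
    have h5 := Finset.card_image_le (s := s.filter (t < ·)) (f := fun a : ℝ => -a)
    rw [signedCount]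
    omega

/-! ### Integration against the signed count, and its relation to the switch function -/

section

open MeasureTheory

theorem even_polynomial_exists_coeff {p : Polynomial ℝ} (hp : ∀ t : ℝ, p.eval (-t) = p.eval t)
    {n : ℕ} (hdeg : p.degree + 2 ≤ ((2 * n : ℕ) : WithBot ℕ)) :
    ∃ c : ℕ → ℝ, ∀ t : ℝ, p.eval t = ∑ k ∈ Finset.range n, c k * t ^ (2 * k) := by
  have hcomp : p.comp (Polynomial.C (-1) * Polynomial.X) = p := by
    refine Polynomial.funext fun t => ?_
    simp [hp]
  have hodd : ∀ k, p.coeff (2 * k + 1) = 0 := by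
    intro k
    have h := congrArg (fun q : Polynomial ℝ => q.coeff (2 * k + 1)) hcomp
    simp only [Polynomial.comp_C_mul_X_coeff, pow_succ, pow_mul] at h
    norm_num at h
    linarith
  have hlt : p.natDegree < 2 * n ∨ p = 0 := by
    by_cases h0 : p = 0
    · exact Or.inr h0
    · left
      rw [Polynomial.degree_eq_natDegree h0] at hdeg
      have : p.natDegree + 2 ≤ 2 * n := by exact_mod_cast hdeg
      omega
  refine ⟨fun k => p.coeff (2 * k), fun t => ?_⟩
  rcases hlt with hlt | rfl
  · rw [Polynomial.eval_eq_sum_range' hlt]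
    clear hlt hdeg
    induction n with
    | zero => simp
    | succ n ih =>
      rw [show 2 * (n + 1) = 2 * n + 1 + 1 by ring, Finset.sum_range_succ, Finset.sum_range_succ,
        Finset.sum_range_succ, ih, hodd]
      ring
  · simp

/-- Evenness folds a negative upper limit onto [0,1], where ∫₀ᵃ p = -∫₀^|a| p. Summed over the
roots, these indicators give `signedCount`. -/
theorem integral_mul_ite_lt {p : ℝ → ℝ} (hp : Continuous p) (heven : ∀ t, p (-t) = p t) {a : ℝ}
    (ha : a ∈ Set.Icc (-1 : ℝ) 1) :
    IntervalIntegrable (fun t => p t * ((if t < a then 1 else 0) - if a < -t then 1 else 0))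
      volume 0 1 ∧
    ∫ t in (0 : ℝ)..1, p t * ((if t < a then 1 else 0) - if a < -t then 1 else 0) =
      ∫ t in (0 : ℝ)..a, p t := by
  have hind : ∀ b ∈ Set.Icc (0 : ℝ) 1,
      IntervalIntegrable (fun t => if t < b then p t else 0) volume 0 1 ∧
      ∫ t in (0 : ℝ)..1, (if t < b then p t else 0) = ∫ t in (0 : ℝ)..b, p t := by
    intro b hb
    have hE₁ : Set.EqOn (fun t => if t < b then p t else 0) p (Set.uIoo 0 b) := by
      intro t ht
      rw [Set.uIoo_of_le hb.1] at ht
      exact if_pos ht.2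
    have hE₂ : Set.EqOn (fun t => if t < b then p t else 0) (fun _ => (0 : ℝ)) (Set.uIoo b 1) := by
      intro t ht
      rw [Set.uIoo_of_le hb.2] at ht
      exact if_neg ht.1.not_gt
    have hi₁ : IntervalIntegrable (fun t => if t < b then p t else 0) volume 0 b :=
      (hp.intervalIntegrable 0 b).congr_uIoo hE₁.symm
    have hi₂ : IntervalIntegrable (fun t => if t < b then p t else 0) volume b 1 :=
      (intervalIntegrable_const (c := (0 : ℝ))).congr_uIoo hE₂.symm
    refine ⟨hi₁.trans hi₂, ?_⟩
    rw [← intervalIntegral.integral_add_adjacent_intervals hi₁ hi₂,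
      intervalIntegral.integral_congr_uIoo hE₁, intervalIntegral.integral_congr_uIoo hE₂]
    simp
  rcases le_total 0 a with h | h
  · have hE : Set.EqOn (fun t => if t < a then p t else 0)
        (fun t => p t * ((if t < a then 1 else 0) - if a < -t then 1 else 0)) (Set.uIoo 0 1) := by
      intro t ht
      rw [Set.uIoo_of_le zero_le_one] at ht
      have : ¬ a < -t := by linarith [ht.1]
      simp [this]
    obtain ⟨h1, h2⟩ := hind a ⟨h, ha.2⟩
    exact ⟨h1.congr_uIoo hE, by rw [← h2, intervalIntegral.integral_congr_uIoo hE]⟩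
  · have hE : Set.EqOn (fun t => -(if t < -a then p t else 0))
        (fun t => p t * ((if t < a then 1 else 0) - if a < -t then 1 else 0)) (Set.uIoo 0 1) := by
      intro t ht
      rw [Set.uIoo_of_le zero_le_one] at ht
      have : ¬ t < a := by linarith [ht.1]
      simp [this, lt_neg]
    obtain ⟨h1, h2⟩ := hind (-a) ⟨by linarith, by linarith [ha.1]⟩
    refine ⟨h1.neg.congr_uIoo hE, ?_⟩
    rw [← intervalIntegral.integral_congr_uIoo hE, intervalIntegral.integral_neg, h2]
    have h3 := intervalIntegral.integral_comp_neg (a := 0) (b := a) p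
    simp only [heven, neg_zero] at h3
    rw [h3, intervalIntegral.integral_symm, neg_neg]

theorem signedCount_eq_sum (s : Finset ℝ) (t : ℝ) :
    (signedCount s t : ℝ) =
      ∑ a ∈ s, ((if t < a then 1 else 0) - if a < -t then 1 else 0) := by
  rw [Finset.sum_sub_distrib, Finset.sum_boole, Finset.sum_boole, signedCount]
  push_cast
  rfl

theorem integral_mul_signedCount {p : ℝ → ℝ} (hp : Continuous p) (heven : ∀ t, p (-t) = p t)
    {s : Finset ℝ} (hs : ∀ a ∈ s, a ∈ Set.Icc (-1 : ℝ) 1) :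
    IntervalIntegrable (fun t => p t * (signedCount s t : ℝ)) volume 0 1 ∧
    ∫ t in (0 : ℝ)..1, p t * (signedCount s t : ℝ) = ∑ a ∈ s, ∫ t in (0 : ℝ)..a, p t := by
  simp only [signedCount_eq_sum, Finset.mul_sum]
  constructor
  · have := IntervalIntegrable.sum s fun a ha => (integral_mul_ite_lt hp heven (hs a ha)).1
    simpa only [Finset.sum_fn] using this
  · rw [intervalIntegral.integral_finsetSum fun a ha => (integral_mul_ite_lt hp heven (hs a ha)).1]
    exact Finset.sum_congr rfl fun a ha => (integral_mul_ite_lt hp heven (hs a ha)).2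

theorem card_filter_abs_le {s : Finset ℝ} {t : ℝ} (ht : 0 ≤ t) :
    ((s.filter (|·| ≤ t)).card : ℤ) =
      s.card - signedCount s t - 2 * (s.filter (· < -t)).card := by
  have h1 := Finset.card_filter_add_card_filter_not (s := s) (fun a => |a| ≤ t)
  have h2 : s.filter (fun a => ¬ |a| ≤ t) = s.filter (t < ·) ∪ s.filter (· < -t) := by
    ext a
    simp only [Finset.mem_filter, Finset.mem_union, not_le, lt_abs, ← and_or_left, lt_neg]
  have h3 : Disjoint (s.filter (t < ·)) (s.filter (· < -t)) := by
    rw [Finset.disjoint_filter]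
    intro a _ h4 h5
    linarith
  rw [h2, Finset.card_union_of_disjoint h3] at h1
  rw [signedCount]
  omega

/-- The number of |a| ≤ t is n - N - 2 #{a < -t}, so its parity is that of n - N; for N in {0, 1}
one has (-1)^N = 1 - 2N. -/
theorem switchFun_abs_eq {n : ℕ} {ζ : Fin n → ℝ} {s : Finset ℝ}
    (hζ : Multiset.map ζ Finset.univ.val = s.val) {t : ℝ} (ht : 0 ≤ t)
    (hcount : signedCount s t = 0 ∨ signedCount s t = 1) :
    switchFun (fun i => |ζ i|) t = (-1) ^ n * (1 - 2 * (signedCount s t : ℝ)) := by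
  have hcard : (Finset.univ.filter fun i => |ζ i| ≤ t).card = (s.filter (|·| ≤ t)).card := by
    have := congrArg (fun m => (Multiset.filter (|·| ≤ t) m).card) hζ
    simp only [Multiset.filter_map, Multiset.card_map] at this
    exact this
  have hn : s.card = n := by
    have := congrArg Multiset.card hζ
    simpa using this.symm
  have h := card_filter_abs_le (s := s) ht
  rw [switchFun, hcard]
  have hz : ((-1 : ℝ)) ^ (s.filter (|·| ≤ t)).card =
      (-1 : ℝ) ^ ((s.filter (|·| ≤ t)).card : ℤ) := (zpow_natCast _ _).symm
  rw [hz, h, hn, zpow_sub₀ (by norm_num), zpow_sub₀ (by norm_num), zpow_mul]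
  rcases hcount with h | h <;> rw [h] <;> norm_num [div_neg]

theorem exists_sorted_abs {n : ℕ} {s : Finset ℝ} (hs : s.card = n) :
    ∃ ζ : Fin n → ℝ, s.val = Multiset.map ζ Finset.univ.val ∧ Monotone fun i => |ζ i| := by
  let f : Fin n → ℝ := s.orderEmbOfFin hs
  refine ⟨f ∘ Tuple.sort (fun i => |f i|), ?_, Tuple.monotone_sort fun i => |f i|⟩
  rw [← Multiset.map_map, Multiset.map_univ_val_equiv]
  have : Finset.univ.map (s.orderEmbOfFin hs).toEmbedding = s := by
    rw [Finset.map_eq_image]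
    exact Finset.image_orderEmbOfFin_univ s hs
  exact (congrArg Finset.val this).symm

end

end SwitchFunctions


/-! ### The main theorem -/

open SwitchFunctions in
theorem mainTheorem4 (n : ℕ) (lam θ : ℝ) (hlam : -1 ≤ lam ∧ lam ≤ 1)
    (hθ : θ = (1 + (-1 : ℝ) ^ ((n : ℤ) - 1) * lam) / 2) :
    (∃ ζ : Fin n → ℝ, SwitchFunctions.IsOrderedRoots (SwitchFunctions.jacobi n θ) ζ) ∧
    ∀ ζ : Fin n → ℝ, SwitchFunctions.IsOrderedRoots (SwitchFunctions.jacobi n θ) ζ →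
      (fun i => |ζ i|) ∈ SwitchFunctions.simplex n ∧
      SwitchFunctions.switchClass (fun i => |ζ i|) ∈ SwitchFunctions.switchSet n ∧
      ∀ p : Polynomial ℝ, (∀ t : ℝ, p.eval (-t) = p.eval t) →
        p.degree + 2 ≤ ((2 * n : ℕ) : WithBot ℕ) →
        SwitchFunctions.pairing (fun t => p.eval t)
          (fun t => SwitchFunctions.switchClass (fun i => |ζ i|) t - lam) = 0 := by
  have hsgn : (-1 : ℝ) ^ ((n : ℤ) - 1) = -(-1) ^ n := by
    rw [zpow_sub₀ (by norm_num), zpow_natCast, zpow_one, div_neg, div_one]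
  rw [hsgn] at hθ
  have hθ01 : 0 ≤ θ ∧ θ ≤ 1 := by
    rcases neg_one_pow_eq_or ℝ n with h | h <;> rw [h] at hθ <;>
      constructor <;> linarith [hlam.1, hlam.2]
  obtain ⟨s, hcard, hs, hroots, c, hc, hprod⟩ := jacobi_roots (n := n) hθ01.1 hθ01.2
  have hode := jacobi_ode n θ
  rw [hprod] at hode
  simp only [Polynomial.derivative_C_mul] at hode
  -- The equation is linear, so the leading coefficient c can be cancelled.
  obtain ⟨K, hK⟩ := exists_first_integral s θ ((n : ℝ) * (n + 1)) (by
    refine eq_zero_of_ne_zero_of_mul_left_eq_zero (Polynomial.C_ne_zero.2 hc) ?_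
    linear_combination hode)
  have hcount : ∀ t : ℝ, 0 ≤ t → signedCount s t = 0 ∨ signedCount s t = 1 := by
    refine fun t ht => signedCount_eq_zero_or_one hs hθ01.1 (K := K) (fun x => ?_) ht
    simpa [Polynomial.eval_finsetSum, Polynomial.eval_prod] using congrArg (Polynomial.eval x) hK
  refine ⟨?_, fun ζ hζ => ?_⟩
  · obtain ⟨ζ, h1, h2⟩ := exists_sorted_abs hcard
    exact ⟨ζ, hroots.trans h1, h2⟩
  have hmem : ∀ i, ζ i ∈ s := by
    intro i
    rw [← Finset.mem_val, ← hroots, hζ.1]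
    exact Multiset.mem_map_of_mem _ (Finset.mem_univ_val i)
  have hsimplex : (fun i => |ζ i|) ∈ simplex n :=
    ⟨hζ.2, fun i => ⟨abs_nonneg _, abs_le.2 ⟨(hs _ (hmem i)).1.le, (hs _ (hmem i)).2⟩⟩⟩
  refine ⟨hsimplex, ⟨_, hsimplex, rfl⟩, fun p hp hdeg => ?_⟩
  obtain ⟨d, hd⟩ := even_polynomial_exists_coeff hp hdeg
  have hI : ∀ a : ℝ, ∫ t in (0 : ℝ)..a, p.eval t =
      ∑ k ∈ Finset.range n, d k / (2 * k + 1) * a ^ (2 * k + 1) := by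
    intro a
    simp only [hd]
    rw [intervalIntegral.integral_finsetSum fun k _ =>
      (Continuous.intervalIntegrable (by fun_prop) _ _)]
    refine Finset.sum_congr rfl fun k _ => ?_
    rw [intervalIntegral.integral_const_mul, integral_pow]
    push_cast
    simp
    ring
  have hsum : ∑ a ∈ s, ∫ t in (0 : ℝ)..a, p.eval t = θ * ∫ t in (0 : ℝ)..1, p.eval t := by
    simp only [hI, one_pow, mul_one]
    rw [Finset.sum_comm, Finset.mul_sum]
    refine Finset.sum_congr rfl fun k hk => ?_
    rw [← Finset.mul_sum, sum_odd_pow_eq s θ K hK (by rw [hcard]; exact Finset.mem_range.1 hk),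
      mul_comm]
  obtain ⟨hint, hval⟩ := integral_mul_signedCount p.continuous hp
    (fun a ha => Set.Ioc_subset_Icc_self (hs a ha))
  have hpi := p.continuous.intervalIntegrable (μ := MeasureTheory.volume) 0 1
  have hae : ∀ᵐ t ∂MeasureTheory.volume, t ∈ Set.uIoc (0 : ℝ) 1 →
      (switchClass (fun i => |ζ i|) t - lam) * p.eval t =
        ((-1) ^ n - lam) * p.eval t - 2 * (-1) ^ n * (p.eval t * (signedCount s t : ℝ)) := by
    have h := (memLp_switchFun fun i => |ζ i|).coeFn_toLp
    rw [Filter.EventuallyEq, MeasureTheory.ae_restrict_iff' measurableSet_Icc] at h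
    filter_upwards [h] with t ht hmt
    rw [Set.uIoc_of_le zero_le_one] at hmt
    rw [switchClass, ht ⟨hmt.1.le, hmt.2⟩,
      switchFun_abs_eq (hζ.1.symm.trans hroots) hmt.1.le (hcount t hmt.1.le)]
    ring
  rw [pairing, intervalIntegral.integral_congr_ae hae,
    intervalIntegral.integral_sub (hpi.const_mul _) (hint.const_mul _),
    intervalIntegral.integral_const_mul, intervalIntegral.integral_const_mul, hval, hsum, hθ]
  have hsq : ((-1 : ℝ) ^ n) * (-1) ^ n = 1 := by rw [← mul_pow]; simp
  -- With ε = (-1)^n and θ = (1 - ελ)/2, the coefficient of ∫₀¹ p is ε - λ - 2εθ = (ε² - 1)λ.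
  linear_combination (lam * ∫ t in (0 : ℝ)..1, p.eval t) * hsq
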